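/- Let $\mathbb N=\{0,1,2,\dots\}$, let $\mathcal P$ be any set of probability distributions on $\mathbb N$, and let $\mathcal P^\infty$ be the set of laws of i.i.d. sequences $X_1,X_2,\dots$ with one-dimensional marginal in $\mathcal P$. Let $\mathbb N^*$ be the set of finite sequences in $\mathbb N$ (including the empty one) and $X^n=(X_1,\dots,X_n)$. An insurance scheme for $\mathcal P^\infty$ is a pair $(\tau,\Pi)$ with $\tau:\mathbb N^*\to\{0,1\}$ and $\Pi:\mathbb N^*\to[0,\infty)$ such that $\tau(x_1,\dots,x_n)=1$ implies $\tau(x_1,\dots,x_{n+1})=1$; $\mu(\sup_n\tau(X^n)=1)=1$ for every $\mu\in\mathcal P^\infty$; and $\Pi(x^n)=0$ whenever $\tau(x^n)=0$. With initial capital $\Pi_0\ge 0$, the scheme goes bankrupt if $$\Pi_0+\sum_{i=1}^n(\Pi(X^{i-1})-X_i)\,1(\tau(X^{i-1})=1)<0\quad\text{for some } n\ge 1.$$ $\mathcal P^\infty$ is insurable by an insurer with initial capital $\Pi_0$ if for every $\eta>0$ there is an insurance scheme $(\tau,\Pi)$ for $\mathcal P^\infty$ such that $\mu((\tau,\Pi)\text{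 goes bankrupt})<\eta$ for all $\mu\in\mathcal P^\infty$. For probability distributions $p,q$ on $\mathbb N$ let $$\mathcal J(p,q)=D\Big(p\,\Big\|\,\frac{p+q}2\Big)+D\Big(q\,\Big\|\,\frac{p+q}2\Big),\qquad D(p\|q)=\sum_{y\in\mathbb N}p(y)\log_2\frac{p(y)}{q(y)}.$$ Let $F_q:[0,\infty]\to[0,1]$ be the continuous piecewise linear distribution function of $q$: $F_q(y)=\sum_{k\le y}q(k)$ if $y=0$ or $y$ is in the support of $q$, $F_q$ is linear between consecutive such points, $F_q=1$ from the largest support point on if the support is finite, and $F_q(\infty)=1$. Let $F_q^{-1}(x)=\inf\{y\in[0,\infty]: F_q(y)\ge x\}$ for $x\in[0,1]$. A distribution $p\in\mathcal P$ is deceptive if for every $\varepsilon>0$ there is $\delta\in(0,1)$ such that for every $f\in[0,\infty)$ there is $q\in\mathcal P$ with $\mathcal J(p,q)<\varepsilon$ and $F_q^{-1}(1-\delta)>f$. **Theorem.** For every $\mathcal P$ and every initial capital $\Pi_0\ge 0$, $\mathcal P^\infty$ is insurable by an insurer with initial capital $\Pi_0$ if and only if no $p\in\mathcal P$ is deceptive.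 -/

import Mathlib

open scoped ENNReal NNReal

namespace Insurance

noncomputable section

open MeasureTheory

/- Loss distributions are elements of `PMF ℕ`; a loss sequence is `ω : ℕ → ℕ`,
where `ω i` is the loss `X_{i+1}`; finite loss sequences are elements of `List ℕ`. -/

/-- The law of an i.i.d. sequence with one-dimensional marginal `p`. -/
def iidLaw (p : PMF ℕ) : Measure (ℕ → ℕ) :=
  Measure.infinitePi fun _ : ℕ => p.toMeasure

/-- The model class of all i.i.d. laws with one-dimensional marginal in `P`. -/
def iidClass (P : Set (PMF ℕ)) : Set (Measure (ℕ → ℕ)) :=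
  iidLaw '' P

/-- The finite sequence of the first `n` losses. -/
def history (ω : ℕ → ℕ) (n : ℕ) : List ℕ :=
  List.ofFn fun i : Fin n => ω i

/-- An insurance scheme for a class `M` of laws on loss sequences: an entry rule and a premium
setting scheme. Once entered the insurer stays entered, it enters almost surely under every
law in `M`, and premiums before the entry are zero. -/
structure InsuranceScheme (M : Set (Measure (ℕ → ℕ))) where
  entered : List ℕ → Bool
  premium : List ℕ → ℝ≥0
  entered_append : ∀ (x : List ℕ) (a : ℕ), entered x = true → entered (x ++ [a]) = true
  enters : ∀ μ ∈ M, μ {ω | ∃ n, entered (history ω n) = true} = 1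
  premium_eq_zero : ∀ x : List ℕ, entered x = false → premium x = 0

/-- The built-up capital after period `n` of an insurer with initial capital `c`. -/
def InsuranceScheme.capital {M : Set (Measure (ℕ → ℕ))} (S : InsuranceScheme M) (c : ℝ≥0)
    (ω : ℕ → ℕ) (n : ℕ) : ℝ :=
  (c : ℝ) + ∑ i ∈ Finset.range n,
    if S.entered (history ω i) = true then (S.premium (history ω i) : ℝ) - (ω i : ℝ) else 0

/-- The event that the insurer with initial capital `c` goes bankrupt. -/
def InsuranceScheme.bankrupt {M : Set (Measure (ℕ → ℕ))} (S : InsuranceScheme M) (c : ℝ≥0) :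
    Set (ℕ → ℕ) :=
  {ω | ∃ n : ℕ, 1 ≤ n ∧ S.capital c ω n < 0}

/-- `M` is insurable by an insurer with initial capital `c`. -/
def InsurableBy (c : ℝ≥0) (M : Set (Measure (ℕ → ℕ))) : Prop :=
  ∀ η : ℝ, 0 < η → ∃ S : InsuranceScheme M, ∀ μ ∈ M, μ (S.bankrupt c) < ENNReal.ofReal η

/-- Relative entropy to base `2` (Mathlib's `klDiv` uses the natural logarithm). -/
def relEntropy (μ ν : Measure ℕ) : ℝ≥0∞ :=
  InformationTheory.klDiv μ ν / ENNReal.ofReal (Real.log 2)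

/-- `D(p ‖ (p+q)/2) + D(q ‖ (p+q)/2)`. -/
def jsDist (p q : PMF ℕ) : ℝ≥0∞ :=
  relEntropy p.toMeasure ((2⁻¹ : ℝ≥0∞) • (p.toMeasure + q.toMeasure)) +
    relEntropy q.toMeasure ((2⁻¹ : ℝ≥0∞) • (p.toMeasure + q.toMeasure))

/-- The probability of `{0, …, n}` under `p`. -/
def massUpTo (p : PMF ℕ) (n : ℕ) : ℝ :=
  ∑ k ∈ Finset.range (n + 1), (p k).toReal

/-- The interpolated cumulative distribution function: it equals `massUpTo p` at `0` and on the
support of `p`, is linear between consecutive such points, and is `1` from the largest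
support point on (if there is one) and at `∞`. -/
def cdf (p : PMF ℕ) (y : ℝ≥0∞) : ℝ :=
  open Classical in
  if y ≠ ⊤ ∧ ∃ b ∈ p.support, y < (b : ℝ≥0∞) then
    -- `a` is the largest point of `{0} ∪ p.support` below `y` (inclusive), `b` the next one
    let a : ℕ := Nat.findGreatest (fun k => k ∈ p.support) ⌊y.toReal⌋₊
    let b : ℕ := sInf {b : ℕ | b ∈ p.support ∧ y < (b : ℝ≥0∞)}
    massUpTo p a + (y.toReal - a) / ((b : ℝ) - a) * (massUpTo p b - massUpTo p a)
  else 1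

/-- The inverse of the interpolated cumulative distribution function. -/
def invCdf (p : PMF ℕ) (x : ℝ) : ℝ≥0∞ :=
  sInf {y : ℝ≥0∞ | x ≤ cdf p y}

/-- The loss distribution `p` is deceptive in the class `P`. -/
def Deceptive (P : Set (PMF ℕ)) (p : PMF ℕ) : Prop :=
  ∀ ε : ℝ, 0 < ε → ∃ δ : ℝ, 0 < δ ∧ δ < 1 ∧ ∀ f : ℝ≥0, ∃ q ∈ P,
    jsDist p q < ENNReal.ofReal ε ∧ (f : ℝ≥0∞) < invCdf q (1 - δ)

end

end Insurance

/-!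
In both directions the proof replaces the two technical notions of the statement by elementary ones.
The interpolated quantile function is large at `1 - δ` if and only if, up to constants, the true
tail is heavy (`massUpTo_lt_of_lt_invCdf`, `le_invCdf_of_massUpTo_lt`). A small divergence forces the
mass functions to be pointwise close (`sq_sub_le_of_jsDist_lt`), and conversely pointwise closeness
on an initial segment carrying most of the mass of `p` makes the divergence small
(`exists_jsDist_lt`, by Scheffé's argument). Hence `p` is not deceptive exactly when some pointwise
neighbourhood of `p` is tight within the class.

*Deceptive implies not insurable* (`not_deceptive_of_insurableBy`). Under `p` the insurer has
entered, after losses at most `K`, by some fixed time `n` with probability above `1/2`. This is an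
event about finitely many masses, so it keeps that probability under all `q` near `p`. Deceptiveness
fixes `δ`, hence a horizon `N` within which a loss from the tail of mass `δ` is likely to occur.
Take levels `K = L₀ ≤ L₁ ≤ …` such that capital built up over this horizon from losses at most `Lⱼ`
is at most `Lⱼ₊₁`, and choose `q` with tail mass more than `δ` beyond a very high level. Among the
many blocks `(Lⱼ, Lⱼ₊₁]` below it, one has mass so small that with high probability no loss falls
into it. The first loss above `Lⱼ` then exceeds `Lⱼ₊₁` and ruins the insurer
(`le_iidLaw_bankrupt`). The pigeonhole step is what handles premiums that react to the losses
observed.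

*No deceptive distribution implies insurable* (`insurableBy_of_not_deceptive`). Pointwise
convergence is second countable, so countably many tight neighbourhoods cover the class
(`exists_countable_tight_cover`). A neighbourhood constrains finitely many masses, so Chebyshev's
inequality tests membership with an error that is uniform over all distributions, and the tests can
be arranged with summable errors. The insurer enters when a test accepts. The premium at time `j`
is the largest of the tail bounds, at level of order `2⁻ʲ`, for the neighbourhoods tested so far.
It depends on `j` only, so a union bound over the tests and the times suffices, with no
conditioning on the entry time.
-/

namespace Insurance

open MeasureTheory ProbabilityTheory InformationTheory Filter Topology

/-! ### Mass functions and their partial sums -/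

lemma hasSum_toReal (p : PMF ℕ) : HasSum (fun k => (p k).toReal) 1 := by
  have h := ENNReal.hasSum_toReal (f := fun k => p k) (by simp [p.tsum_coe])
  rwa [← ENNReal.tsum_toReal_eq (fun k => p.apply_ne_top k), p.tsum_coe, ENNReal.toReal_one] at h

lemma massUpTo_mono (p : PMF ℕ) : Monotone (massUpTo p) := by
  intro m n h
  exact Finset.sum_le_sum_of_subset_of_nonneg (Finset.range_subset_range.2 (by omega))
    fun _ _ _ => ENNReal.toReal_nonneg

lemma massUpTo_nonneg (p : PMF ℕ) (n : ℕ) : 0 ≤ massUpTo p n :=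
  Finset.sum_nonneg fun _ _ => ENNReal.toReal_nonneg

lemma massUpTo_le_one (p : PMF ℕ) (n : ℕ) : massUpTo p n ≤ 1 :=
  sum_le_hasSum _ (fun _ _ => ENNReal.toReal_nonneg) (hasSum_toReal p)

lemma tendsto_massUpTo (p : PMF ℕ) : Tendsto (massUpTo p) atTop (𝓝 1) :=
  ((hasSum_toReal p).tendsto_sum_nat).comp (tendsto_add_atTop_nat 1)

lemma massUpTo_eq_one_of_support_le (p : PMF ℕ) (n : ℕ) (h : ∀ b ∈ p.support, b ≤ n) :
    massUpTo p n = 1 := by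
  refine (hasSum_toReal p).unique (hasSum_sum_of_ne_finset_zero ?_) |>.symm
  intro b hb
  have : p b = 0 := by
    by_contra h0
    have := h b ((p.mem_support_iff b).2 h0)
    simp at hb; omega
  simp [this]

/-! ### Quantiles and tails -/

lemma massUpTo_findGreatest_support (p : PMF ℕ) [DecidablePred (· ∈ p.support)] (n : ℕ) :
    massUpTo p (Nat.findGreatest (fun k => k ∈ p.support) n) = massUpTo p n := by
  refine Finset.sum_subset (Finset.range_subset_range.2 ?_) ?_
  · have := Nat.findGreatest_le (P := fun k => k ∈ p.support) n
    omega
  · intro k hk hk'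
    have : p k = 0 := by
      by_contra h0
      have := Nat.le_findGreatest (P := fun k => k ∈ p.support) (m := k) (n := n)
        (by simp at hk; omega) ((p.mem_support_iff k).2 h0)
      rw [Finset.mem_range] at hk'; omega
    simp [this]

/-- The interpolated distribution function dominates the true one, so a large quantile
forces a heavy tail. -/
lemma massUpTo_lt_of_lt_invCdf (q : PMF ℕ) (M : ℕ) (x : ℝ)
    (h : ((M : ℝ≥0) : ℝ≥0∞) < invCdf q x) : massUpTo q M < x := by
  classical
  have h1 : cdf q (M : ℝ≥0∞) < x := by
    by_contra! h2
    exact absurd (sInf_le (show (M : ℝ≥0∞) ∈ {y | x ≤ cdf q y} from h2))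
      (not_le.2 (by simpa [invCdf] using h))
  refine lt_of_le_of_lt ?_ h1
  unfold cdf
  split_ifs with hc
  · simp only [ENNReal.toReal_natCast, Nat.floor_natCast]
    rw [massUpTo_findGreatest_support]
    obtain ⟨-, b, hb⟩ := hc
    have hs := Nat.sInf_mem (s := {b : ℕ | b ∈ q.support ∧ (M : ℝ≥0∞) < b}) ⟨b, hb⟩
    set B := sInf {b : ℕ | b ∈ q.support ∧ (M : ℝ≥0∞) < b}
    have hMB : M < B := by exact_mod_cast hs.2
    have ha : Nat.findGreatest (fun k => k ∈ q.support) M ≤ M := Nat.findGreatest_le _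
    have ha' : ((Nat.findGreatest (fun k => k ∈ q.support) M : ℕ) : ℝ) ≤ M := by exact_mod_cast ha
    have hMB' : (M : ℝ) < B := by exact_mod_cast hMB
    have := massUpTo_mono q hMB.le
    have : 0 ≤ ((M : ℝ) - (Nat.findGreatest (fun k => k ∈ q.support) M : ℕ)) /
        (B - (Nat.findGreatest (fun k => k ∈ q.support) M : ℕ)) *
          (massUpTo q B - massUpTo q M) := by
      refine mul_nonneg (div_nonneg ?_ ?_) ?_ <;> linarith
    linarith
  · exact massUpTo_le_one q M

/-- A heavy tail forces a large quantile. Linear interpolation can move mass down from the next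
support point, but at most half of it below half of that point. -/
lemma le_invCdf_of_massUpTo_lt (q : PMF ℕ) (M : ℕ) (d : ℝ) (hd : 0 < d)
    (h : massUpTo q (2 * M) < 1 - d) : (M : ℝ≥0∞) ≤ invCdf q (1 - d / 2) := by
  classical
  refine le_sInf fun y hy => ?_
  by_contra! hyM
  simp only [Set.mem_ofPred_eq] at hy
  have hex : ∃ b ∈ q.support, 2 * M < b := by
    by_contra! hb
    have := massUpTo_eq_one_of_support_le q (2 * M) hb
    linarith
  obtain ⟨b, hb, hMb⟩ := hex
  have hytop : y ≠ ⊤ := hyM.ne_top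
  have hyr : y.toReal < M := by
    have := (ENNReal.toReal_lt_toReal hytop (by simp)).2 hyM
    simpa using this
  have hyb : y < (b : ℝ≥0∞) := hyM.trans_le (by exact_mod_cast (by omega : M ≤ b))
  unfold cdf at hy
  rw [if_pos ⟨hytop, b, hb, hyb⟩] at hy
  simp only at hy
  rw [massUpTo_findGreatest_support] at hy
  have hs := Nat.sInf_mem (s := {b : ℕ | b ∈ q.support ∧ y < (b : ℝ≥0∞)}) ⟨b, hb, hyb⟩
  set B := sInf {b : ℕ | b ∈ q.support ∧ y < (b : ℝ≥0∞)}
  have hyB : y.toReal < B := by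
    have := (ENNReal.toReal_lt_toReal hytop (by simp)).2 hs.2
    simpa using this
  have hfl : (⌊y.toReal⌋₊ : ℝ) ≤ y.toReal := Nat.floor_le ENNReal.toReal_nonneg
  set a := Nat.findGreatest (fun k => k ∈ q.support) ⌊y.toReal⌋₊
  have ha : (a : ℝ) ≤ y.toReal :=
    le_trans (by exact_mod_cast Nat.findGreatest_le (P := fun k => k ∈ q.support) _) hfl
  have hfM : ⌊y.toReal⌋₊ ≤ 2 * M := by
    have : (⌊y.toReal⌋₊ : ℝ) < M := lt_of_le_of_lt hfl hyr
    have : ⌊y.toReal⌋₊ < M := by exact_mod_cast this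
    omega
  have h1 := massUpTo_mono q hfM
  have h0 : massUpTo q ⌊y.toReal⌋₊ ≤ massUpTo q B := by
    apply massUpTo_mono
    have : (⌊y.toReal⌋₊ : ℝ) < B := lt_of_le_of_lt hfl hyB
    exact_mod_cast this.le
  have h2 := massUpTo_le_one q B
  have ha0 : (0 : ℝ) ≤ a := Nat.cast_nonneg _
  by_cases hBM : B ≤ 2 * M
  · have h3 := massUpTo_mono q hBM
    have : (y.toReal - a) / (B - a) ≤ 1 := by
      rw [div_le_one (by linarith)]; linarith
    nlinarith
  · have hBM' : (2 * M : ℝ) < B := by exact_mod_cast not_le.1 hBM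
    have : (y.toReal - a) / (B - a) ≤ 1 / 2 := by
      rw [div_le_iff₀ (by linarith)]; linarith
    nlinarith

/-! ### The Jensen–Shannon divergence and pointwise closeness -/

/-- The divergence from the midpoint as a sum. Where both masses vanish the quotient is `0 / 0 = 0`,
but the factor in front of it makes the term `0`, as it should be. -/
lemma klDiv_midpoint (p q : PMF ℕ) :
    klDiv p.toMeasure ((2⁻¹ : ℝ≥0∞) • (p.toMeasure + q.toMeasure)) =
      ∑' k, ENNReal.ofReal ((((p k).toReal + (q k).toReal) / 2) *
        klFun ((p k).toReal / (((p k).toReal + (q k).toReal) / 2))) := by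
  set m := (2⁻¹ : ℝ≥0∞) • (p.toMeasure + q.toMeasure) with hm
  have hfin : IsFiniteMeasure m := Measure.smul_finite _ (by simp)
  have hmk : ∀ k, m {k} = ENNReal.ofReal (((p k).toReal + (q k).toReal) / 2) := by
    intro k
    rw [div_eq_inv_mul, ENNReal.ofReal_mul (by positivity), ENNReal.ofReal_add (by positivity)
      (by positivity), ENNReal.ofReal_toReal (p.apply_ne_top k),
      ENNReal.ofReal_toReal (q.apply_ne_top k), ENNReal.ofReal_inv_of_pos (by norm_num)]
    simp [hm, PMF.toMeasure_apply_singleton, mul_add]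
  have hac : p.toMeasure ≪ m := by
    refine Measure.AbsolutelyContinuous.mk fun s _ hs => ?_
    simp only [hm, Measure.smul_apply, Measure.add_apply, smul_eq_mul, mul_eq_zero,
      add_eq_zero] at hs
    rcases hs with hs | hs
    · simp at hs
    · exact hs.1
  rw [klDiv_eq_lintegral_klFun_of_ac hac, lintegral_countable']
  refine tsum_congr fun k => ?_
  have hr : (p.toMeasure.rnDeriv m k) * m {k} = p k := by
    have := Measure.setLIntegral_rnDeriv hac {k}
    rwa [lintegral_singleton, PMF.toMeasure_apply_singleton _ _ (measurableSet_singleton k)] at this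
  have hr' := congrArg ENNReal.toReal hr
  rw [ENNReal.toReal_mul, hmk, ENNReal.toReal_ofReal (by positivity)] at hr'
  rw [hmk, mul_comm, ← ENNReal.ofReal_mul (by positivity)]
  rcases eq_or_ne (((p k).toReal + (q k).toReal) / 2) 0 with h0 | h0
  · simp [h0]
  · rw [← eq_div_iff h0] at hr'
    rw [hr']

lemma sqrt_sub_one_sq_le_klFun {r : ℝ} (hr : 0 ≤ r) : (√r - 1) ^ 2 ≤ klFun r := by
  rcases hr.eq_or_lt with rfl | hr
  · simp [klFun_zero]
  have hs : 0 < √r := Real.sqrt_pos.2 hr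
  have hsq : √r ^ 2 = r := Real.sq_sqrt hr.le
  have h1 := Real.one_sub_inv_le_log_of_pos hs
  have h2 : Real.log r = 2 * Real.log √r := by
    rw [Real.log_sqrt hr.le]; ring
  rw [klFun_apply, h2]
  have h3 : r * (1 - (√r)⁻¹) ≤ r * Real.log √r := by gcongr
  have h4 : r * (1 - (√r)⁻¹) = r - √r := by
    field_simp; nlinarith
  nlinarith

lemma klFun_le_sub_one_sq {r : ℝ} (hr : 0 ≤ r) : klFun r ≤ (r - 1) ^ 2 := by
  rcases hr.eq_or_lt with rfl | hr
  · simp [klFun_zero]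
  have := Real.log_le_sub_one_of_pos hr
  rw [klFun_apply]
  nlinarith

/-- The constant comes from `(r - 1) ^ 2 = (√r - 1) ^ 2 * (√r + 1) ^ 2 ≤ 9 * klFun r`, valid for
the ratio `r` to the midpoint, and from the midpoint halving the difference `a - b`. -/
lemma sq_sub_div_le_mul_klFun {a b : ℝ} (ha : 0 ≤ a) (hb : 0 ≤ b) (ha1 : a ≤ 1) (hb1 : b ≤ 1) :
    (a - b) ^ 2 / 36 ≤ (a + b) / 2 * klFun (a / ((a + b) / 2)) := by
  rcases (add_nonneg ha hb).eq_or_lt with h0 | h0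
  · have h1 : a = 0 := by linarith
    have h2 : b = 0 := by linarith
    simp [h1, h2]
  set m := (a + b) / 2 with hm
  have hm0 : 0 < m := by linarith
  set r := a / m with hr
  have hrm : r * m = a := div_mul_cancel₀ _ hm0.ne'
  have hr0 : 0 ≤ r := by positivity
  have hr4 : r ≤ 4 := by rw [hr, div_le_iff₀ hm0]; linarith
  have h1 := sqrt_sub_one_sq_le_klFun hr0
  have hs0 := Real.sqrt_nonneg r
  have hs2 : √r ≤ 2 := by
    rw [Real.sqrt_le_left (by norm_num)]; linarith
  have hsq : √r ^ 2 = r := Real.sq_sqrt hr0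
  have h2 : (r - 1) ^ 2 ≤ 9 * klFun r := by
    have h3 : (r - 1) ^ 2 = (√r - 1) ^ 2 * (√r + 1) ^ 2 := by
      rw [← mul_pow]; congr 1; linarith
    have h4 : (√r + 1) ^ 2 ≤ 9 := by nlinarith
    nlinarith [sq_nonneg (√r - 1)]
  have h5 : (a - b) ^ 2 = 4 * m ^ 2 * (r - 1) ^ 2 := by
    have : a - b = 2 * (m * r - m) := by rw [mul_comm m r, hrm, hm]; ring
    rw [this]; ring
  have hm1 : m ≤ 1 := by linarith
  have h6 : m ^ 2 ≤ m := by nlinarith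
  have h7 : 0 ≤ (r - 1) ^ 2 := sq_nonneg _
  rw [h5]
  nlinarith [mul_le_mul_of_nonneg_right h6 h7, mul_le_mul_of_nonneg_left h2 hm0.le]

lemma mul_klFun_le_abs_sub {a b : ℝ} (ha : 0 ≤ a) (hb : 0 ≤ b) :
    (a + b) / 2 * klFun (a / ((a + b) / 2)) ≤ |a - b| := by
  rcases (add_nonneg ha hb).eq_or_lt with h0 | h0
  · have h1 : a = 0 := by linarith
    have h2 : b = 0 := by linarith
    simp [h1, h2]
  set m := (a + b) / 2 with hm
  have hm0 : 0 < m := by linarith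
  have h1 := klFun_le_sub_one_sq (show 0 ≤ a / m by positivity)
  have h2 : m * (a / m - 1) ^ 2 = |a - b| * (|a - b| / (4 * m)) := by
    rw [mul_div_assoc', abs_mul_abs_self]
    have : a - b = 2 * (a - m) := by rw [hm]; ring
    rw [this]; field_simp; ring
  have h3 : |a - b| / (4 * m) ≤ 1 := by
    rw [div_le_one (by linarith), abs_le]; constructor <;> linarith
  calc m * klFun (a / m) ≤ m * (a / m - 1) ^ 2 := by gcongr
    _ = |a - b| * (|a - b| / (4 * m)) := h2
    _ ≤ |a - b| * 1 := by gcongr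
    _ = |a - b| := mul_one _

lemma toReal_apply_le_one (p : PMF ℕ) (k : ℕ) : (p k).toReal ≤ 1 :=
  ENNReal.toReal_le_of_le_ofReal (by norm_num) (by simpa using p.coe_le_one k)

/-- A form of Pinsker's inequality: the divergence controls each mass difference. -/
lemma sq_sub_le_of_jsDist_lt (p q : PMF ℕ) (ε : ℝ) (hε : 0 < ε)
    (h : jsDist p q < ENNReal.ofReal ε) (k : ℕ) :
    ((p k).toReal - (q k).toReal) ^ 2 ≤ 36 * ε := by
  have h1 : ENNReal.ofReal (((p k).toReal - (q k).toReal) ^ 2 / 36) ≤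
      klDiv p.toMeasure ((2⁻¹ : ℝ≥0∞) • (p.toMeasure + q.toMeasure)) := by
    rw [klDiv_midpoint]
    refine le_trans (ENNReal.ofReal_le_ofReal ?_) (ENNReal.le_tsum k)
    exact sq_sub_div_le_mul_klFun ENNReal.toReal_nonneg ENNReal.toReal_nonneg
      (toReal_apply_le_one p k) (toReal_apply_le_one q k)
  have h2 : klDiv p.toMeasure ((2⁻¹ : ℝ≥0∞) • (p.toMeasure + q.toMeasure)) ≤ jsDist p q := by
    refine le_trans ?_ le_self_add
    rw [relEntropy, ENNReal.le_div_iff_mul_le (by simp [Real.log_pos]) (by simp)]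
    refine mul_le_of_le_one_right' ?_
    rw [ENNReal.ofReal_le_one]
    exact (Real.log_two_lt_d9.trans (by norm_num)).le
  have h3 := (ENNReal.ofReal_lt_ofReal_iff hε).1 ((h1.trans h2).trans_lt h)
  linarith

lemma klDiv_midpoint_le (p q : PMF ℕ) :
    klDiv p.toMeasure ((2⁻¹ : ℝ≥0∞) • (p.toMeasure + q.toMeasure)) ≤
      ∑' k, ENNReal.ofReal |(p k).toReal - (q k).toReal| := by
  rw [klDiv_midpoint]
  exact ENNReal.tsum_le_tsum fun k => ENNReal.ofReal_le_ofReal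
    (mul_klFun_le_abs_sub ENNReal.toReal_nonneg ENNReal.toReal_nonneg)

/-- Scheffé's argument: for probability distributions, closeness on an initial segment that
carries most of the mass of `p` bounds the whole `ℓ¹` distance. -/
lemma tsum_abs_sub_le (p q : PMF ℕ) (K : ℕ) :
    ∑' k, ENNReal.ofReal |(p k).toReal - (q k).toReal| ≤
      ENNReal.ofReal (2 * (∑ k ∈ Finset.range (K + 1), |(p k).toReal - (q k).toReal| +
        (1 - massUpTo p K))) := by
  have hp := hasSum_toReal p
  have hq := hasSum_toReal q
  have hmax : ∀ k, max ((p k).toReal - (q k).toReal) 0 ≤ (p k).toReal := fun k =>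
    max_le (by linarith [ENNReal.toReal_nonneg (a := q k)]) ENNReal.toReal_nonneg
  have hs : Summable fun k => max ((p k).toReal - (q k).toReal) 0 :=
    Summable.of_nonneg_of_le (fun _ => le_max_right _ _) hmax hp.summable
  have habs : HasSum (fun k => |(p k).toReal - (q k).toReal|)
      (2 * (∑' k, max ((p k).toReal - (q k).toReal) 0) - (1 - 1)) := by
    have heq : (fun k => |(p k).toReal - (q k).toReal|) = fun k =>
        2 * max ((p k).toReal - (q k).toReal) 0 - ((p k).toReal - (q k).toReal) := by
      funext k
      rcases le_total 0 ((p k).toReal - (q k).toReal) with h | h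
      · rw [abs_of_nonneg h, max_eq_left h]; ring
      · rw [abs_of_nonpos h, max_eq_right h]; ring
    rw [heq]
    exact (hs.hasSum.mul_left 2).sub (hp.sub hq)
  have htail : ∑' k, (p (k + (K + 1))).toReal = 1 - massUpTo p K := by
    have := hp.summable.sum_add_tsum_nat_add (K + 1)
    rw [hp.tsum_eq] at this
    rw [massUpTo]; linarith
  have h1 := hs.sum_add_tsum_nat_add (K + 1)
  have h2 : ∑ k ∈ Finset.range (K + 1), max ((p k).toReal - (q k).toReal) 0 ≤
      ∑ k ∈ Finset.range (K + 1), |(p k).toReal - (q k).toReal| :=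
    Finset.sum_le_sum fun k _ => max_le (le_abs_self _) (abs_nonneg _)
  have h3 : ∑' k, max ((p (k + (K + 1))).toReal - (q (k + (K + 1))).toReal) 0 ≤
      ∑' k, (p (k + (K + 1))).toReal := by
    have hp' : Summable fun k => (p (k + (K + 1))).toReal :=
      hp.summable.comp_injective (add_left_injective (K + 1))
    have hs' : Summable fun k => max ((p (k + (K + 1))).toReal - (q (k + (K + 1))).toReal) 0 :=
      hs.comp_injective (add_left_injective (K + 1))
    exact hs'.tsum_le_tsum (fun k => hmax (k + (K + 1))) hp'
  rw [← ENNReal.ofReal_tsum_of_nonneg (fun _ => abs_nonneg _) habs.summable, habs.tsum_eq]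
  exact ENNReal.ofReal_le_ofReal (by linarith)

/-- Divergence balls contain neighbourhoods for the topology of pointwise convergence. -/
lemma exists_jsDist_lt (p : PMF ℕ) (ε : ℝ) (hε : 0 < ε) :
    ∃ (K : ℕ) (α : ℝ), 0 < α ∧ ∀ q : PMF ℕ,
      (∀ k ≤ K, |(q k).toReal - (p k).toReal| < α) → jsDist p q < ENNReal.ofReal ε := by
  set L := Real.log 2 with hL
  have hL0 : 0 < L := Real.log_pos (by norm_num)
  obtain ⟨K, hK⟩ := ((tendsto_massUpTo p).eventually
    (lt_mem_nhds (show 1 - ε * L / 16 < 1 by have := mul_pos hε hL0; linarith))).exists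
  refine ⟨K, ε * L / 16 / (K + 1), by positivity, fun q hq => ?_⟩
  have hsum : ∑ k ∈ Finset.range (K + 1), |(p k).toReal - (q k).toReal| ≤ ε * L / 16 := by
    calc _ ≤ ∑ k ∈ Finset.range (K + 1), ε * L / 16 / (K + 1) := by
          refine Finset.sum_le_sum fun k hk => ?_
          rw [abs_sub_comm]
          exact (hq k (by simp at hk; omega)).le
      _ = ε * L / 16 := by
          rw [Finset.sum_const, Finset.card_range, nsmul_eq_mul]; push_cast; field_simp
  have hpos := mul_pos hε hL0
  have hT : ∑' k, ENNReal.ofReal |(p k).toReal - (q k).toReal| ≤ ENNReal.ofReal (ε * L / 4) :=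
    (tsum_abs_sub_le p q K).trans (ENNReal.ofReal_le_ofReal (by linarith))
  have hdiv : ENNReal.ofReal (ε * L / 4) / ENNReal.ofReal L = ENNReal.ofReal (ε / 4) := by
    rw [← ENNReal.ofReal_div_of_pos hL0]; congr 1; field_simp
  have h1 : relEntropy p.toMeasure ((2⁻¹ : ℝ≥0∞) • (p.toMeasure + q.toMeasure)) ≤
      ENNReal.ofReal (ε / 4) := by
    rw [relEntropy, ← hdiv]
    exact ENNReal.div_le_div_right ((klDiv_midpoint_le p q).trans hT) _
  have h2 : relEntropy q.toMeasure ((2⁻¹ : ℝ≥0∞) • (p.toMeasure + q.toMeasure)) ≤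
      ENNReal.ofReal (ε / 4) := by
    rw [relEntropy, ← hdiv, add_comm p.toMeasure]
    refine ENNReal.div_le_div_right ((klDiv_midpoint_le q p).trans ?_) _
    simpa only [abs_sub_comm] using hT
  calc jsDist p q ≤ ENNReal.ofReal (ε / 4) + ENNReal.ofReal (ε / 4) := add_le_add h1 h2
    _ = ENNReal.ofReal (ε / 4 + ε / 4) := (ENNReal.ofReal_add (by positivity) (by positivity)).symm
    _ < ENNReal.ofReal ε := (ENNReal.ofReal_lt_ofReal_iff hε).2 (by linarith)

/-! ### Loss histories and i.i.d. laws -/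

instance (p : PMF ℕ) : IsProbabilityMeasure (iidLaw p) := by
  unfold iidLaw; infer_instance

lemma history_succ (ω : ℕ → ℕ) (n : ℕ) : history ω (n + 1) = history ω n ++ [ω n] := by
  rw [history, List.ofFn_succ_last]
  rfl

lemma measurableSet_history (n : ℕ) (s : Set (List ℕ)) :
    MeasurableSet {ω : ℕ → ℕ | history ω n ∈ s} := by
  have hm : Measurable fun (ω : ℕ → ℕ) (i : Fin n) => ω i := by fun_prop
  exact hm (MeasurableSet.of_discrete (s := {g : Fin n → ℕ | List.ofFn g ∈ s}))

lemma iidLaw_real_pi (p : PMF ℕ) (s : Finset ℕ) (t : ℕ → Set ℕ) :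
    (iidLaw p).real {ω | ∀ i ∈ s, ω i ∈ t i} = ∏ i ∈ s, p.toMeasure.real (t i) := by
  have h : {ω : ℕ → ℕ | ∀ i ∈ s, ω i ∈ t i} = (s : Set ℕ).pi t := by
    ext ω; simp [Set.pi]
  rw [h, measureReal_def, iidLaw, Measure.infinitePi_pi _ fun _ _ => MeasurableSet.of_discrete,
    ENNReal.toReal_prod]
  rfl

lemma iidLaw_real_eval (p : PMF ℕ) (i : ℕ) (t : Set ℕ) :
    (iidLaw p).real {ω | ω i ∈ t} = p.toMeasure.real t := by
  simpa using iidLaw_real_pi p {i} fun _ => t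

lemma toMeasure_real_singleton (p : PMF ℕ) (k : ℕ) : p.toMeasure.real {k} = (p k).toReal := by
  rw [measureReal_def, PMF.toMeasure_apply_singleton _ _ (measurableSet_singleton k)]

lemma toMeasure_real_Iic (p : PMF ℕ) (M : ℕ) : p.toMeasure.real (Set.Iic M) = massUpTo p M := by
  have h : Set.Iic M = ((Finset.range (M + 1) : Finset ℕ) : Set ℕ) := by
    ext k; simp
  rw [h, ← sum_measureReal_singleton]
  exact Finset.sum_congr rfl fun k _ => toMeasure_real_singleton p k

lemma toMeasure_real_Ioi (p : PMF ℕ) (M : ℕ) :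
    p.toMeasure.real (Set.Ioi M) = 1 - massUpTo p M := by
  rw [← Set.compl_Iic, measureReal_compl MeasurableSet.of_discrete, toMeasure_real_Iic]
  simp

lemma toMeasure_real_Ioc (p : PMF ℕ) {M M' : ℕ} (h : M ≤ M') :
    p.toMeasure.real (Set.Ioc M M') = massUpTo p M' - massUpTo p M := by
  have hd : Set.Ioc M M' = Set.Iic M' \ Set.Iic M := by
    ext k; simp [and_comm]
  rw [hd, measureReal_sdiff (Set.Iic_subset_Iic.2 h) MeasurableSet.of_discrete,
    toMeasure_real_Iic, toMeasure_real_Iic]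

/-! ### Deceptive distributions prevent insurance -/

section Necessity

variable {M : Set (Measure (ℕ → ℕ))}

lemma InsuranceScheme.entered_history_mono (S : InsuranceScheme M) (ω : ℕ → ℕ) {m n : ℕ}
    (h : m ≤ n) (hm : S.entered (history ω m) = true) : S.entered (history ω n) = true := by
  induction n, h using Nat.le_induction with
  | base => exact hm
  | succ n _ ih => rw [history_succ]; exact S.entered_append _ _ ih

/-- The premiums charged within a fixed time after histories of bounded losses are bounded. -/
lemma InsuranceScheme.exists_capital_bound (S : InsuranceScheme M) (c : ℝ≥0) (T K : ℕ) :
    ∃ B : ℕ, K ≤ B ∧ ∀ (ω : ℕ → ℕ) (i : ℕ), i < T → (∀ k < i, ω k ≤ K) →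
      (c : ℝ) + ∑ k ∈ Finset.range (i + 1), (S.premium (history ω k) : ℝ) ≤ B := by
  have h1 : ∀ k : ℕ, ∃ b : ℝ≥0, ∀ ω : ℕ → ℕ, (∀ j < k, ω j ≤ K) →
      S.premium (history ω k) ≤ b := by
    intro k
    refine ⟨Finset.univ.sup fun g : Fin k → Fin (K + 1) =>
      S.premium (List.ofFn fun i => (g i : ℕ)), fun ω hω => ?_⟩
    exact Finset.le_sup (f := fun g : Fin k → Fin (K + 1) =>
      S.premium (List.ofFn fun i => (g i : ℕ)))
      (Finset.mem_univ fun i : Fin k => (⟨ω i, Nat.lt_succ_of_le (hω i i.2)⟩ : Fin (K + 1)))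
  choose b hb using h1
  obtain ⟨B, hB⟩ := exists_nat_ge ((c : ℝ) + ∑ k ∈ Finset.range T, (b k : ℝ))
  refine ⟨max K B, le_max_left _ _, fun ω i hi hω => ?_⟩
  have h2 : ∑ k ∈ Finset.range (i + 1), (S.premium (history ω k) : ℝ) ≤
      ∑ k ∈ Finset.range (i + 1), (b k : ℝ) := by
    refine Finset.sum_le_sum fun k hk => ?_
    rw [Finset.mem_range] at hk
    exact_mod_cast hb k ω fun j hj => hω j (by omega)
  have h3 : ∑ k ∈ Finset.range (i + 1), (b k : ℝ) ≤ ∑ k ∈ Finset.range T, (b k : ℝ) :=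
    Finset.sum_le_sum_of_subset_of_nonneg (Finset.range_subset_range.2 (by omega))
      fun _ _ _ => NNReal.coe_nonneg _
  have h4 : (B : ℝ) ≤ (max K B : ℕ) := by exact_mod_cast le_max_right K B
  linarith

/-- Once the insurer has entered, a loss that exceeds everything collected so far is ruinous. -/
lemma InsuranceScheme.mem_bankrupt (S : InsuranceScheme M) (c : ℝ≥0) (ω : ℕ → ℕ) {n i : ℕ}
    (hni : n ≤ i) (hn : S.entered (history ω n) = true)
    (h : (c : ℝ) + ∑ k ∈ Finset.range (i + 1), (S.premium (history ω k) : ℝ) < ω i) :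
    ω ∈ S.bankrupt c := by
  refine ⟨i + 1, by omega, ?_⟩
  have hi := S.entered_history_mono ω hni hn
  rw [Finset.sum_range_succ] at h
  rw [InsuranceScheme.capital, Finset.sum_range_succ, if_pos hi]
  have : ∑ k ∈ Finset.range i, (if S.entered (history ω k) = true then
      (S.premium (history ω k) : ℝ) - (ω k : ℝ) else 0) ≤
      ∑ k ∈ Finset.range i, (S.premium (history ω k) : ℝ) := by
    refine Finset.sum_le_sum fun k _ => ?_
    split_ifs
    · linarith [Nat.cast_nonneg (α := ℝ) (ω k)]
    · exact NNReal.coe_nonneg _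
  linarith

/-- The event that the insurer has entered by time `n` while all losses were at most `K`. -/
def enteredBounded (S : InsuranceScheme M) (n K : ℕ) : Set (ℕ → ℕ) :=
  {ω | S.entered (history ω n) = true ∧ ∀ i < n, ω i ≤ K}

lemma exists_half_lt_enteredBounded (S : InsuranceScheme M) (p : PMF ℕ) (hp : iidLaw p ∈ M) :
    ∃ n K, 1 / 2 < (iidLaw p).real (enteredBounded S n K) := by
  have h1 : ∃ n, 1 / 2 < iidLaw p {ω | S.entered (history ω n) = true} := by
    have hmono : Monotone fun n => {ω | S.entered (history ω n) = true} :=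
      fun m n hmn ω => S.entered_history_mono ω hmn
    have := tendsto_measure_iUnion_atTop (μ := iidLaw p) hmono
    rw [← Set.ofPred_exists, S.enters _ hp] at this
    exact (this.eventually (lt_mem_nhds (by simp))).exists
  obtain ⟨n, hn⟩ := h1
  have hmono : Monotone (enteredBounded S n) :=
    fun K L hKL ω hω => ⟨hω.1, fun i hi => (hω.2 i hi).trans hKL⟩
  have hU : ⋃ K, enteredBounded S n K = {ω | S.entered (history ω n) = true} := by
    ext ω
    simp only [enteredBounded, Set.mem_iUnion, Set.mem_ofPred_eq]
    refine ⟨fun ⟨_, h⟩ => h.1, fun h => ⟨(Finset.range n).sup ω, h, fun i hi => ?_⟩⟩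
    exact Finset.le_sup (f := ω) (Finset.mem_range.2 hi)
  have := tendsto_measure_iUnion_atTop (μ := iidLaw p) hmono
  rw [hU] at this
  obtain ⟨K, hK⟩ := (this.eventually (lt_mem_nhds hn)).exists
  refine ⟨n, K, ?_⟩
  have := (ENNReal.toReal_lt_toReal (by simp) (measure_ne_top _ _)).2 hK
  simpa [measureReal_def] using this

/-- The probability of a bounded history event is a polynomial in the masses. -/
lemma iidLaw_real_enteredBounded (S : InsuranceScheme M) (n K : ℕ) (p : PMF ℕ) :
    (iidLaw p).real (enteredBounded S n K) =
      ∑ g : Fin n → Fin (K + 1) with S.entered (List.ofFn fun i => (g i : ℕ)) = true,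
        ∏ i, (p (g i)).toReal := by
  have hU : enteredBounded S n K =
      ⋃ g ∈ Finset.univ.filter fun g : Fin n → Fin (K + 1) =>
        S.entered (List.ofFn fun i => (g i : ℕ)) = true,
        {ω : ℕ → ℕ | ∀ i : Fin n, ω i = g i} := by
    ext ω
    simp only [enteredBounded, Set.mem_iUnion, Set.mem_ofPred_eq, Finset.mem_filter,
      Finset.mem_univ, true_and, exists_prop]
    constructor
    · rintro ⟨h1, h2⟩
      exact ⟨fun i => ⟨ω i, Nat.lt_succ_of_le (h2 i i.2)⟩, h1, fun i => rfl⟩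
    · rintro ⟨g, hg, hω⟩
      refine ⟨?_, fun i hi => ?_⟩
      · simpa only [history, hω] using hg
      · rw [hω ⟨i, hi⟩]; exact Nat.lt_succ_iff.1 (g _).2
  have hmeas : ∀ g : Fin n → Fin (K + 1),
      MeasurableSet {ω : ℕ → ℕ | ∀ i : Fin n, ω i = g i} := by
    intro g
    rw [Set.ofPred_forall]
    exact MeasurableSet.iInter fun i => measurable_pi_apply (i : ℕ) (measurableSet_singleton _)
  rw [hU, measureReal_biUnion_finset _ fun g _ => hmeas g]
  · refine Finset.sum_congr rfl fun g _ => ?_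
    have h := iidLaw_real_pi p (Finset.range n)
      fun i => if h : i < n then {(g ⟨i, h⟩ : ℕ)} else Set.univ
    rw [Finset.prod_range] at h
    simp only [Fin.is_lt, dite_true, Fin.eta, toMeasure_real_singleton] at h
    rw [← h]
    congr 1
    ext ω
    simp only [Set.mem_ofPred_eq, Finset.mem_range]
    refine ⟨fun hω i hi => by simpa [hi] using hω ⟨i, hi⟩, fun hω i => ?_⟩
    simpa using hω i i.2
  · intro g _ g' _ hgg'
    refine Set.disjoint_left.2 fun ω hω hω' => hgg' ?_
    funext i
    exact Fin.ext ((hω i).symm.trans (hω' i))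

lemma exists_half_lt_enteredBounded_of_close (S : InsuranceScheme M) (n K : ℕ) (p : PMF ℕ)
    (h : 1 / 2 < (iidLaw p).real (enteredBounded S n K)) :
    ∃ ε : ℝ, 0 < ε ∧ ∀ q : PMF ℕ, (∀ k, |(q k).toReal - (p k).toReal| < ε) →
      1 / 2 < (iidLaw q).real (enteredBounded S n K) := by
  let φ : (Fin (K + 1) → ℝ) → ℝ := fun v =>
    ∑ g : Fin n → Fin (K + 1) with S.entered (List.ofFn fun i => (g i : ℕ)) = true,
      ∏ i, v (g i)
  have hφ : Continuous φ := by fun_prop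
  rw [iidLaw_real_enteredBounded] at h
  have hev := hφ.continuousAt (x := fun k : Fin (K + 1) => (p k).toReal) |>.eventually
    (lt_mem_nhds h)
  obtain ⟨ε, hε, hball⟩ := Metric.eventually_nhds_iff.1 hev
  refine ⟨ε, hε, fun q hq => ?_⟩
  rw [iidLaw_real_enteredBounded]
  exact hball (y := fun k : Fin (K + 1) => (q k).toReal)
    ((dist_pi_lt_iff hε).2 fun k => by rw [Real.dist_eq]; exact hq k)

/-- Among many consecutive blocks, one has small mass. -/
lemma exists_block_le (q : PMF ℕ) (L : ℕ → ℕ) (J : ℕ) (hJ : 0 < J) :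
    ∃ j < J, massUpTo q (L (j + 1)) - massUpTo q (L j) ≤ 1 / J := by
  by_contra! h
  have h1 : ∑ j ∈ Finset.range J, (1 / J : ℝ) <
      ∑ j ∈ Finset.range J, (massUpTo q (L (j + 1)) - massUpTo q (L j)) :=
    Finset.sum_lt_sum_of_nonempty (Finset.nonempty_range_iff.2 hJ.ne')
      fun j hj => h j (Finset.mem_range.1 hj)
  rw [Finset.sum_range_sub (fun j => massUpTo q (L j)), Finset.sum_const, Finset.card_range,
    nsmul_eq_mul, mul_one_div_cancel (by positivity)] at h1
  linarith [massUpTo_le_one q (L J), massUpTo_nonneg q (L 0)]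

/-- If a law is likely to have small losses while the insurer enters, to exceed the level `m`
soon afterwards, and unlikely to land between `m` and the largest capital `m'` that could have
been accumulated from losses below `m`, then bankruptcy is likely. -/
lemma le_iidLaw_bankrupt (S : InsuranceScheme M) (c : ℝ≥0) (q : PMF ℕ) (n N K m m' : ℕ)
    (hKm : K ≤ m) (hmm' : m ≤ m')
    (hm' : ∀ (ω : ℕ → ℕ) (i : ℕ), i < n + N → (∀ k < i, ω k ≤ m) →
      (c : ℝ) + ∑ k ∈ Finset.range (i + 1), (S.premium (history ω k) : ℝ) ≤ m') :
    (iidLaw q).real (enteredBounded S n K) ≤ (iidLaw q).real (S.bankrupt c) +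
      massUpTo q m ^ N + N * (massUpTo q m' - massUpTo q m) := by
  have hsub : enteredBounded S n K ⊆ (S.bankrupt c ∪
      {ω | ∀ i ∈ Finset.Ico n (n + N), ω i ∈ Set.Iic m}) ∪
      ⋃ i ∈ Finset.Ico n (n + N), {ω | ω i ∈ Set.Ioc m m'} := by
    rintro ω ⟨h1, h2⟩
    by_contra hω
    simp only [Set.mem_union, Set.mem_iUnion, Set.mem_ofPred_eq, not_or, Set.mem_Iic,
      Set.mem_Ioc, exists_prop, not_exists, not_and, not_forall] at hω
    obtain ⟨⟨hb, i, hi, him⟩, hgap⟩ := hω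
    classical
    have hex : ∃ i, m < ω i := ⟨i, not_le.1 him⟩
    -- the first loss above `m`
    set i₀ := Nat.find hex with hi₀
    have hlarge : m < ω i₀ := Nat.find_spec hex
    have hsmall : ∀ k < i₀, ω k ≤ m := fun k hk => not_lt.1 (Nat.find_min hex hk)
    have hle : i₀ ≤ i := Nat.find_le (not_le.1 him)
    have hn : n ≤ i₀ := by
      by_contra! hlt
      exact absurd (h2 i₀ hlt) (by omega)
    rw [Finset.mem_Ico] at hi
    have hgap' := hgap i₀ (Finset.mem_Ico.2 ⟨hn, by omega⟩) hlarge
    refine hb (S.mem_bankrupt c ω hn h1 (lt_of_le_of_lt (hm' ω i₀ (by omega) hsmall) ?_))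
    exact_mod_cast not_le.1 hgap'
  refine (measureReal_mono hsub).trans ((measureReal_union_le _ _).trans ?_)
  refine add_le_add ((measureReal_union_le _ _).trans (add_le_add le_rfl ?_)) ?_
  · rw [iidLaw_real_pi]
    simp [toMeasure_real_Iic]
  · refine (measureReal_biUnion_finset_le _ _).trans ?_
    simp only [iidLaw_real_eval, toMeasure_real_Ioc q hmm']
    simp [mul_sub]

theorem not_deceptive_of_insurableBy (P : Set (PMF ℕ)) (c : ℝ≥0)
    (h : InsurableBy c (iidClass P)) (p : PMF ℕ) (hp : p ∈ P) : ¬ Deceptive P p := by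
  intro hdec
  obtain ⟨S, hS⟩ := h (1 / 4) (by norm_num)
  obtain ⟨n, K, hnK⟩ := exists_half_lt_enteredBounded S p ⟨p, hp, rfl⟩
  obtain ⟨ε, hε, hclose⟩ := exists_half_lt_enteredBounded_of_close S n K p hnK
  obtain ⟨δ, hδ, hδ1, hq⟩ := hdec (ε ^ 2 / 72) (by positivity)
  obtain ⟨N, hN⟩ := exists_pow_lt_of_lt_one (show (0 : ℝ) < 1 / 8 by norm_num)
    (show 1 - δ < 1 by linarith)
  choose B hKB hB using S.exists_capital_bound c (n + N)
  -- the levels `K`, `B K`, `B (B K)`, …: capital built from losses below one stays below the next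
  have hLmono : Monotone fun j => B^[j] K :=
    monotone_nat_of_le_succ fun j => by
      rw [Function.iterate_succ_apply']; exact hKB _
  obtain ⟨q, hqP, hqp, hqf⟩ := hq ((B^[8 * N + 1] K : ℕ) : ℝ≥0)
  have htail := massUpTo_lt_of_lt_invCdf q _ _ hqf
  obtain ⟨j, hj, hblock⟩ := exists_block_le q (fun j => B^[j] K) (8 * N + 1) (by omega)
  rw [Function.iterate_succ_apply'] at hblock
  have hcl : ∀ k, |(q k).toReal - (p k).toReal| < ε := by
    intro k
    have := sq_sub_le_of_jsDist_lt p q _ (by positivity) hqp k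
    rw [abs_sub_comm]
    exact abs_lt_of_sq_lt_sq (by nlinarith [sq_nonneg ε, pow_pos hε 2]) hε.le
  have hA := hclose q hcl
  have hmain := le_iidLaw_bankrupt S c q n N K (B^[j] K) (B (B^[j] K))
    (hLmono (Nat.zero_le j)) (hKB _) (hB _)
  have h1 : massUpTo q (B^[j] K) ^ N ≤ (1 - δ) ^ N :=
    pow_le_pow_left₀ (massUpTo_nonneg _ _) ((massUpTo_mono q (hLmono hj.le)).trans htail.le) _
  have h2 : N * (massUpTo q (B (B^[j] K)) - massUpTo q (B^[j] K)) ≤ 1 / 8 := by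
    calc _ ≤ (N : ℝ) * (1 / (8 * N + 1 : ℕ)) := by gcongr
      _ ≤ 1 / 8 := by
        rw [mul_one_div, div_le_div_iff₀ (by positivity) (by norm_num)]
        push_cast; linarith
  have h3 := hS _ ⟨q, hqP, rfl⟩
  have h4 : (iidLaw q).real (S.bankrupt c) < 1 / 4 := by
    rw [measureReal_def]
    exact (ENNReal.lt_ofReal_iff_toReal_lt (measure_ne_top _ _)).1 h3
  linarith

end Necessity

/-! ### Empirical frequencies -/

/-- The relative frequency of `k` in a finite sequence. -/
noncomputable def empFreq (x : List ℕ) (k : ℕ) : ℝ := (x.count k : ℝ) / x.length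

@[simp] lemma length_history (ω : ℕ → ℕ) (n : ℕ) : (history ω n).length = n := by
  simp [history]

lemma count_history (ω : ℕ → ℕ) (n k : ℕ) :
    ((history ω n).count k : ℝ) = ∑ i ∈ Finset.range n, if ω i = k then (1 : ℝ) else 0 := by
  induction n with
  | zero => simp [history]
  | succ n ih =>
    rw [history_succ, List.count_append, Finset.sum_range_succ, ← ih]
    simp [List.count_singleton]

lemma take_history (ω : ℕ → ℕ) {m n : ℕ} (h : m ≤ n) : (history ω n).take m = history ω m := by
  refine List.ext_getElem (by simp [h]) fun i h1 h2 => ?_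
  simp [history]

/-- Chebyshev's inequality for empirical frequencies. -/
lemma iidLaw_empFreq_le (q : PMF ℕ) (k n : ℕ) (hn : 0 < n) (a : ℝ) (ha : 0 < a) :
    iidLaw q {ω | a ≤ |empFreq (history ω n) k - (q k).toReal|} ≤
      ENNReal.ofReal (1 / (n * a ^ 2)) := by
  have hn' : (0 : ℝ) < n := by exact_mod_cast hn
  let f : ℕ → ℝ := fun x => if x = k then 1 else 0
  have hf : Measurable f := measurable_from_nat
  let X : ℕ → (ℕ → ℕ) → ℝ := fun i ω => f (ω i)
  have hX : ∀ i, Measurable (X i) := fun i => hf.comp (measurable_pi_apply i)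
  have hind : iIndepFun X (iidLaw q) := iIndepFun_infinitePi fun _ => hf
  have hb : ∀ i ω, X i ω ∈ Set.Icc (0 : ℝ) 1 := by
    intro i ω
    simp only [X, f]
    split_ifs <;> simp
  have hLp : ∀ i, MemLp (X i) 2 (iidLaw q) := fun i =>
    MemLp.of_bound (hX i).aestronglyMeasurable 1 (ae_of_all _ fun ω => by
      rw [Real.norm_eq_abs, abs_of_nonneg (hb i ω).1]; exact (hb i ω).2)
  have hmean : ∀ i, ∫ ω, X i ω ∂(iidLaw q) = (q k).toReal := by
    intro i
    have h1 : X i = Set.indicator {ω : ℕ → ℕ | ω i ∈ ({k} : Set ℕ)} 1 := by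
      funext ω
      simp [X, f, Set.indicator_apply]
    have hmeas : MeasurableSet {ω : ℕ → ℕ | ω i ∈ ({k} : Set ℕ)} :=
      measurable_pi_apply i MeasurableSet.of_discrete
    rw [h1, integral_indicator_one hmeas, iidLaw_real_eval, toMeasure_real_singleton]
  have hvar : Var[∑ i ∈ Finset.range n, X i; iidLaw q] ≤ n := by
    rw [IndepFun.variance_sum (fun i _ => hLp i) fun i _ j _ hij => hind.indepFun hij]
    calc _ ≤ ∑ i ∈ Finset.range n, (1 : ℝ) := Finset.sum_le_sum fun i _ =>
          (variance_le_sq_of_bounded (ae_of_all _ (hb i)) (hX i).aemeasurable).trans (by norm_num)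
      _ = n := by simp
  have hsum : ∫ ω, (∑ i ∈ Finset.range n, X i) ω ∂(iidLaw q) = n * (q k).toReal := by
    simp only [Finset.sum_apply]
    rw [integral_finsetSum _ fun i _ => (hLp i).integrable (by norm_num)]
    simp [hmean]
  have hcheb := meas_ge_le_variance_div_sq (μ := iidLaw q)
    (memLp_finsetSum' (Finset.range n) fun i _ => hLp i) (c := n * a) (by positivity)
  rw [hsum] at hcheb
  refine le_trans (le_of_eq ?_) (hcheb.trans (ENNReal.ofReal_le_ofReal ?_))
  · congr 1
    ext ω
    have : empFreq (history ω n) k - (q k).toReal =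
        ((∑ i ∈ Finset.range n, X i) ω - n * (q k).toReal) / n := by
      rw [empFreq, count_history, length_history, Finset.sum_apply]
      field_simp
      rfl
    rw [Set.mem_ofPred_eq, Set.mem_ofPred_eq, this, abs_div, abs_of_pos hn', le_div_iff₀ hn',
      mul_comm]
  · calc _ ≤ (n : ℝ) / (n * a) ^ 2 := by gcongr
      _ = 1 / (n * a ^ 2) := by field_simp

/-! ### Insurance without deceptive distributions -/

/-- The pointwise neighbourhood of `p` of radius `α` on `{0, …, K}`. -/
def nbhd (p : PMF ℕ) (K : ℕ) (α : ℝ) : Set (PMF ℕ) :=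
  {q | ∀ k ≤ K, |(q k).toReal - (p k).toReal| < α}

/-- The tails of the distributions in `Q` are uniformly small. -/
def IsTightSet (Q : Set (PMF ℕ)) : Prop :=
  ∀ d : ℝ, 0 < d → ∃ m : ℕ, ∀ q ∈ Q, 1 - massUpTo q m ≤ d

lemma exists_tight_nbhd (P : Set (PMF ℕ)) (p : PMF ℕ) (h : ¬ Deceptive P p) :
    ∃ K α, 0 < α ∧ IsTightSet (P ∩ nbhd p K α) := by
  unfold Deceptive at h
  push Not at h
  obtain ⟨ε, hε, h⟩ := h
  obtain ⟨K, α, hα, hK⟩ := exists_jsDist_lt p ε hε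
  refine ⟨K, α, hα, fun d hd => ?_⟩
  obtain ⟨f, hf⟩ := h (min (d / 2) (1 / 2)) (by positivity)
    (lt_of_le_of_lt (min_le_right _ _) (by norm_num))
  obtain ⟨m, hm⟩ := exists_nat_gt f
  refine ⟨2 * m, fun q hq => ?_⟩
  by_contra! hlt
  have h1 := le_invCdf_of_massUpTo_lt q m (2 * min (d / 2) (1 / 2)) (by positivity)
    (by linarith [min_le_left (d / 2) (1 / 2)])
  rw [mul_div_cancel_left₀ _ two_ne_zero] at h1
  have h2 := h1.trans (hf q hq.1 (hK q hq.2))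
  exact absurd hm (not_lt.2 (by exact_mod_cast h2))

/-- Pointwise convergence is second countable, so countably many tight neighbourhoods, shrunk by
a factor `4`, cover the class. -/
lemma exists_countable_tight_cover (P : Set (PMF ℕ)) (hP : P.Nonempty)
    (h : ∀ p ∈ P, ¬ Deceptive P p) :
    ∃ (p : ℕ → PMF ℕ) (K : ℕ → ℕ) (α : ℕ → ℝ), (∀ i, 0 < α i) ∧
      (∀ i, IsTightSet (P ∩ nbhd (p i) (K i) (α i))) ∧
      ∀ q ∈ P, ∃ i, q ∈ nbhd (p i) (K i) (α i / 4) := by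
  have h1 : ∀ p, ∃ K α, 0 < α ∧ (p ∈ P → IsTightSet (P ∩ nbhd p K α)) := by
    intro p
    by_cases hp : p ∈ P
    · obtain ⟨K, α, hα, ht⟩ := exists_tight_nbhd P p (h p hp)
      exact ⟨K, α, hα, fun _ => ht⟩
    · exact ⟨0, 1, one_pos, fun hp' => absurd hp' hp⟩
  choose K α hα ht using h1
  let v : PMF ℕ → ℕ → ℝ := fun p k => (p k).toReal
  let _ : TopologicalSpace (PMF ℕ) := TopologicalSpace.induced v inferInstance
  have _ : SecondCountableTopology (PMF ℕ) := TopologicalSpace.secondCountableTopology_induced _ _ v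
  have hv : Continuous v := continuous_induced_dom
  have hnb : ∀ p ∈ P, nbhd p (K p) (α p / 4) ∈ 𝓝[P] p := by
    intro p _
    refine mem_nhdsWithin_of_mem_nhds ?_
    have : ∀ᶠ q in 𝓝 p, ∀ k ∈ Finset.range (K p + 1), |v q k - v p k| < α p / 4 := by
      rw [Filter.eventually_all_finset]
      intro k _
      have hc : Continuous fun q => |v q k - v p k| := by fun_prop
      exact hc.continuousAt.eventually (gt_mem_nhds (by simpa using hα p))
    filter_upwards [this] with q hq k hk
    exact hq k (Finset.mem_range.2 (by omega))
  obtain ⟨T, hTP, hTc, hT⟩ := TopologicalSpace.countable_cover_nhdsWithin hnb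
  have hTne : T.Nonempty := by
    obtain ⟨q, hq⟩ := hP
    obtain ⟨p, hp, -⟩ := Set.mem_iUnion₂.1 (hT hq)
    exact ⟨p, hp⟩
  obtain ⟨p, rfl⟩ := hTc.exists_eq_range hTne
  refine ⟨p, fun i => K (p i), fun i => α (p i), fun i => hα _, fun i => ht _ (hTP ⟨i, rfl⟩), ?_⟩
  intro q hq
  simpa using hT hq

/-- The event that, in a sample of size `n` from `q`, some empirical frequency of a value up to `K`
is off by at least `a`. -/
def badSample (q : PMF ℕ) (K n : ℕ) (a : ℝ) : Set (ℕ → ℕ) :=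
  {ω | ∃ k ≤ K, a ≤ |empFreq (history ω n) k - (q k).toReal|}

lemma exists_sample_size (K : ℕ) (a e : ℝ) (ha : 0 < a) (he : 0 < e) :
    ∃ n, ∀ q, iidLaw q (badSample q K n a) ≤ ENNReal.ofReal e := by
  obtain ⟨n, hn⟩ := exists_nat_gt ((K + 1) / (e * a ^ 2))
  have hn' : (0 : ℝ) < n := lt_of_le_of_lt (by positivity) hn
  refine ⟨n, fun q => ?_⟩
  have hsub : badSample q K n a ⊆ ⋃ k ∈ Finset.range (K + 1),
      {ω | a ≤ |empFreq (history ω n) k - (q k).toReal|} := by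
    rintro ω ⟨k, hk, hω⟩
    exact Set.mem_iUnion₂.2 ⟨k, Finset.mem_range.2 (by omega), hω⟩
  refine (measure_mono hsub).trans ((measure_biUnion_finset_le _ _).trans ?_)
  calc _ ≤ ∑ k ∈ Finset.range (K + 1), ENNReal.ofReal (1 / (n * a ^ 2)) :=
        Finset.sum_le_sum fun k _ => iidLaw_empFreq_le q k n (by exact_mod_cast hn') a ha
    _ = ENNReal.ofReal ((K + 1 : ℕ) * (1 / (n * a ^ 2))) := by
        rw [Finset.sum_const, Finset.card_range, nsmul_eq_mul,
          ENNReal.ofReal_mul (Nat.cast_nonneg _), ENNReal.ofReal_natCast]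
    _ ≤ ENNReal.ofReal e := by
        refine ENNReal.ofReal_le_ofReal ?_
        rw [div_lt_iff₀ (by positivity)] at hn
        rw [mul_one_div, div_le_iff₀ (by positivity)]
        push_cast
        nlinarith

/-- The insurer has entered if some test `A t`, applied to the first `n t` losses, has accepted.
Only tests with `t` at most the elapsed time are consulted. -/
def enteredByTests (A : ℕ → List ℕ → Prop) (n : ℕ → ℕ) (x : List ℕ) : Prop :=
  ∃ t ≤ x.length, n t ≤ x.length ∧ A t (x.take (n t))

lemma enteredByTests_history {A : ℕ → List ℕ → Prop} {n : ℕ → ℕ} {ω : ℕ → ℕ} {j : ℕ} :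
    enteredByTests A n (history ω j) ↔ ∃ t ≤ j, n t ≤ j ∧ A t (history ω (n t)) := by
  simp only [enteredByTests, length_history]
  refine exists_congr fun t => and_congr_right fun _ => and_congr_right fun h => ?_
  rw [take_history ω h]

open Classical in
/-- The scheme that enters according to a sequence of tests and from then on charges a premium
`level j` depending only on the time `j`. -/
noncomputable def schemeOfTests (M : Set (Measure (ℕ → ℕ))) (A : ℕ → List ℕ → Prop) (n : ℕ → ℕ)
    (level : ℕ → ℕ)
    (h : ∀ μ ∈ M, μ {ω | ∃ j, enteredByTests A n (history ω j)} = 1) : InsuranceScheme M where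
  entered x := decide (enteredByTests A n x)
  premium x := if enteredByTests A n x then level x.length else 0
  entered_append x a hx := by
    rw [decide_eq_true_iff] at hx ⊢
    obtain ⟨t, ht, hn, hA⟩ := hx
    refine ⟨t, by simp; omega, by simp; omega, ?_⟩
    rwa [List.take_append_of_le_length hn]
  enters μ hμ := by simpa using h μ hμ
  premium_eq_zero x hx := if_neg (of_decide_eq_false hx)

/-- The scheme survives as long as every loss after entry is covered by the premium. -/
lemma exists_lt_of_mem_bankrupt {M : Set (Measure (ℕ → ℕ))} {A : ℕ → List ℕ → Prop} {n : ℕ → ℕ}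
    {level : ℕ → ℕ} {h : ∀ μ ∈ M, μ {ω | ∃ j, enteredByTests A n (history ω j)} = 1}
    {c : ℝ≥0} {ω : ℕ → ℕ} (hω : ω ∈ (schemeOfTests M A n level h).bankrupt c) :
    ∃ j, enteredByTests A n (history ω j) ∧ level j < ω j := by
  by_contra! hle
  obtain ⟨N, -, hN⟩ := hω
  refine absurd hN (not_lt.2 (add_nonneg (NNReal.coe_nonneg c) (Finset.sum_nonneg fun j _ => ?_)))
  split_ifs with hj
  · have hj' : enteredByTests A n (history ω j) := by simpa [schemeOfTests] using hj
    have := hle j hj'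
    simp only [schemeOfTests, if_pos hj', length_history, NNReal.coe_natCast, sub_nonneg]
    exact_mod_cast this
  · exact le_rfl

lemma insurableBy_of_not_deceptive (P : Set (PMF ℕ)) (c : ℝ≥0)
    (h : ∀ p ∈ P, ¬ Deceptive P p) : InsurableBy c (iidClass P) := by
  intro η hη
  rcases P.eq_empty_or_nonempty with rfl | hP
  · exact ⟨schemeOfTests _ (fun _ _ => False) id id (by simp [iidClass]), by simp [iidClass]⟩
  obtain ⟨p, K, α, hα, htight, hcover⟩ := exists_countable_tight_cover P hP h
  -- error budget: the `e j` sum to `η / 4`, once for the tests and once for the tails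
  let e : ℕ → ℝ := fun j => η / 4 / 2 / 2 ^ j
  have he : ∀ j, 0 < e j := fun j => by positivity
  have hsum : ∑' j, ENNReal.ofReal (e j) = ENNReal.ofReal (η / 4) := by
    rw [← ENNReal.ofReal_tsum_of_nonneg (fun j => (he j).le) (summable_geometric_two' _),
      tsum_geometric_two']
  -- test `t = Nat.pair i m` is the `m`-th test of neighbourhood `i`
  let idx : ℕ → ℕ := fun t => t.unpair.1
  choose n hn using fun t => exists_sample_size (K (idx t)) (α (idx t) / 4) (e t)
    (by linarith [hα (idx t)]) (he t)
  choose m hm using fun i j => htight i (e j) (he j)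
  let level : ℕ → ℕ := fun j => (Finset.range (j + 1)).sup fun t => m (idx t) j
  let A : ℕ → List ℕ → Prop := fun t x =>
    ∀ k ≤ K (idx t), |empFreq x k - (p (idx t) k).toReal| < α (idx t) / 2
  have henter : ∀ μ ∈ iidClass P, μ {ω | ∃ j, enteredByTests A n (history ω j)} = 1 := by
    rintro _ ⟨q, hq, rfl⟩
    obtain ⟨i, hi⟩ := hcover q hq
    have hmeas : MeasurableSet {ω | ∃ j, enteredByTests A n (history ω j)} := by
      rw [Set.ofPred_exists]
      exact MeasurableSet.iUnion fun j => measurableSet_history j {x | enteredByTests A n x}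
    rw [← prob_compl_eq_zero_iff hmeas]
    have hle : ∀ k, iidLaw q {ω | ∃ j, enteredByTests A n (history ω j)}ᶜ ≤
        ENNReal.ofReal (e (Nat.pair i k)) := by
      intro k
      refine (measure_mono ?_).trans (hn (Nat.pair i k) q)
      intro ω hω
      by_contra hgood
      refine hω ⟨max (Nat.pair i k) (n (Nat.pair i k)), enteredByTests_history.2
        ⟨Nat.pair i k, le_max_left _ _, le_max_right _ _, fun l hl => ?_⟩⟩
      have hidx : idx (Nat.pair i k) = i := by simp [idx]
      simp only [badSample, Set.mem_ofPred_eq, not_exists, not_and, not_le, hidx] at hgood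
      rw [hidx] at hl ⊢
      have h1 := hgood l hl
      have h2 := hi l hl
      have h3 := abs_sub_le (empFreq (history ω (n (Nat.pair i k))) l) (q l).toReal
        (p i l).toReal
      linarith
    have hlim : Tendsto (fun k => ENNReal.ofReal (e (Nat.pair i k))) atTop (𝓝 0) := by
      have h1 : Tendsto (fun j => ENNReal.ofReal (e j)) atTop (𝓝 0) := by
        have : ∑' j, ENNReal.ofReal (e j) ≠ ∞ := by rw [hsum]; simp
        exact ENNReal.tendsto_atTop_zero_of_tsum_ne_top this
      exact h1.comp (tendsto_atTop_mono (fun k => Nat.right_le_pair i k) tendsto_id)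
    exact le_antisymm (ge_of_tendsto' hlim hle) zero_le
  refine ⟨schemeOfTests _ A n level henter, ?_⟩
  rintro _ ⟨q, hq, rfl⟩
  -- a tail event only counts from the first time a correct neighbourhood can have been accepted
  let tail : ℕ → Set (ℕ → ℕ) := fun j =>
    {ω | (∃ t ≤ j, q ∈ nbhd (p (idx t)) (K (idx t)) (α (idx t))) ∧ level j < ω j}
  have htail : ∀ j, iidLaw q (tail j) ≤ ENNReal.ofReal (e j) := by
    intro j
    by_cases hj : ∃ t ≤ j, q ∈ nbhd (p (idx t)) (K (idx t)) (α (idx t))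
    · obtain ⟨t, htj, hqt⟩ := hj
      have hlev : m (idx t) j ≤ level j :=
        Finset.le_sup (f := fun t => m (idx t) j) (Finset.mem_range.2 (by omega))
      have h1 : iidLaw q (tail j) ≤ iidLaw q {ω | ω j ∈ Set.Ioi (level j)} :=
        measure_mono fun ω hω => hω.2
      refine h1.trans ?_
      rw [← ofReal_measureReal, iidLaw_real_eval, toMeasure_real_Ioi]
      refine ENNReal.ofReal_le_ofReal (le_trans ?_ (hm (idx t) j q ⟨hq, hqt⟩))
      linarith [massUpTo_mono q hlev]
    · have : tail j = ∅ := by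
        ext ω
        simp only [tail, Set.mem_ofPred_eq, Set.mem_empty_iff_false, iff_false]
        exact fun hω => hj hω.1
      simp [this]
  have hsub : (schemeOfTests _ A n level henter).bankrupt c ⊆
      (⋃ t, badSample q (K (idx t)) (n t) (α (idx t) / 4)) ∪ ⋃ j, tail j := by
    intro ω hω
    obtain ⟨j, hj, hlt⟩ := exists_lt_of_mem_bankrupt hω
    obtain ⟨t, htj, -, hA⟩ := enteredByTests_history.1 hj
    by_cases hbad : ω ∈ badSample q (K (idx t)) (n t) (α (idx t) / 4)
    · exact Or.inl (Set.mem_iUnion.2 ⟨t, hbad⟩)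
    · refine Or.inr (Set.mem_iUnion.2 ⟨j, ⟨t, htj, fun l hl => ?_⟩, hlt⟩)
      simp only [badSample, Set.mem_ofPred_eq, not_exists, not_and, not_le] at hbad
      have h1 := hbad l hl
      have h2 := hA l hl
      have h3 := abs_sub_le (q l).toReal (empFreq (history ω (n t)) l) (p (idx t) l).toReal
      rw [abs_sub_comm (q l).toReal (empFreq _ _)] at h3
      linarith [hα (idx t)]
  calc iidLaw q ((schemeOfTests _ A n level henter).bankrupt c)
      ≤ ENNReal.ofReal (η / 4) + ENNReal.ofReal (η / 4) := by
        refine (measure_mono hsub).trans ((measure_union_le _ _).trans (add_le_add ?_ ?_))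
        · exact (measure_iUnion_le _).trans (hsum ▸ ENNReal.tsum_le_tsum fun t => hn t q)
        · exact (measure_iUnion_le _).trans (hsum ▸ ENNReal.tsum_le_tsum htail)
    _ = ENNReal.ofReal (η / 4 + η / 4) :=
        (ENNReal.ofReal_add (by positivity) (by positivity)).symm
    _ < ENNReal.ofReal η := (ENNReal.ofReal_lt_ofReal_iff hη).2 (by linarith)

end Insurance

theorem mainTheorem1 (P : Set (PMF ℕ)) (c : ℝ≥0) :
    Insurance.InsurableBy c (Insurance.iidClass P) ↔
      ∀ p ∈ P, ¬ Insurance.Deceptive P p :=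
  ⟨Insurance.not_deceptive_of_insurableBy P c, Insurance.insurableBy_of_not_deceptive P c⟩
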